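/- Let $r\ge 1$ and let $\Gamma$ be an extra-special $2$-group of order $2^{2r+1}$, that is, a finite group of this order whose center $Z(\Gamma)$ is isomorphic to $\mathbb{Z}/2$ and whose quotient $\Gamma/Z(\Gamma)$ is a direct product of copies of $\mathbb{Z}/2$. Let $1\to\Gamma\to G'\xrightarrow{q}G\to 1$ be a short exact sequence of groups, let $\alpha,\beta\in G$ be commuting elements, and let $$L(\alpha,\beta,q)=\{(a,b)\in G'\times G' \mid q(a)=\alpha,\ q(b)=\beta,\ ab=ba\}.$$ The group $G$ acts on the one-dimensional complex representations $\chi:\Gamma\to\mathbb{C}^\times$ by $(\chi\cdot g)(\gamma)=\chi(\tilde g\gamma\tilde g^{-1})$, where $\tilde g\in q^{-1}(g)$ is arbitrary. Let $N$ be the number of non-trivial one-dimensional representations of $\Gamma$ that are fixed by the action of the subgroup of $G$ generated by $\alpha$ and $\beta$ (so, if $\alpha$ and $\beta$ generate $G$, the number of those fixed by $G$). Then $L(\alpha,\beta,q)$ is finite and either $|L(\alpha,\beta,q)|=0$ or $$|L(\alpha,\beta,q)|=2^{2r+1}(1+N+1)\quad\text{or}\quad |L(\alpha,\beta,q)|=2^{2r+1}(1+N-1).$$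 -/

import Mathlib

universe u v w

/-- A finite group `Γ` is extra-special (for the prime `p`) if its order is a power of `p`, its
center is isomorphic to `ℤ/p`, and `Γ / Z(Γ)` is a direct product of copies of `ℤ/p`. -/
structure IsExtraSpecial (p : ℕ) (Γ : Type u) [Group Γ] : Prop where
  prime : p.Prime
  finite : Finite Γ
  card_eq_pow : ∃ n : ℕ, Nat.card Γ = p ^ n
  center_equiv : Nonempty (Subgroup.center Γ ≃* Multiplicative (ZMod p))
  quotient_equiv : ∃ m : ℕ, Nonempty (Γ ⧸ Subgroup.center Γ ≃* (Fin m → Multiplicative (ZMod p)))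

namespace GroupExtension

variable {Γ : Type u} {G' : Type v} {G : Type w} [Group Γ] [Group G'] [Group G]

/-- The set `L(α, β, q)` of pairs of commuting elements of `G'` projecting to `α` and `β`. -/
def commutingLifts (S : GroupExtension Γ G' G) (α β : G) : Set (G' × G') :=
  {x | S.rightHom x.1 = α ∧ S.rightHom x.2 = β ∧ x.1 * x.2 = x.2 * x.1}

/-- The one-dimensional representation `γ ↦ χ (a γ a⁻¹)` of `Γ`, for `a : G'`. -/
noncomputable def conjChar (S : GroupExtension Γ G' G) (a : G') (χ : Γ →* ℂˣ) : Γ →* ℂˣ :=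
  χ.comp (S.conjAct a).toMonoidHom

/-- `conjChar S a χ` depends only on the image of `a` in `G`, so that it defines an action of `G`
on the one-dimensional representations of `Γ`. -/
theorem conjChar_eq_of_rightHom_eq (S : GroupExtension Γ G' G) {a b : G'}
    (h : S.rightHom a = S.rightHom b) (χ : Γ →* ℂˣ) : S.conjChar a χ = S.conjChar b χ := by
  have hm : b⁻¹ * a ∈ S.inl.range := by
    rw [S.range_inl_eq_ker_rightHom, MonoidHom.mem_ker, map_mul, map_inv, h, inv_mul_cancel]
  obtain ⟨n, hn⟩ := hm
  have ha : a = b * S.inl n := by rw [hn, mul_inv_cancel_left]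
  ext γ
  have key : S.conjAct a γ = S.conjAct b (n * γ * n⁻¹) := by
    apply S.inl_injective
    rw [S.inl_conjAct_comm, S.inl_conjAct_comm, ha]
    simp only [map_mul, map_inv, mul_inv_rev, mul_assoc]
  have : χ (S.conjAct a γ) = χ (S.conjAct b γ) := by
    rw [key]
    simp only [map_mul, map_inv]
    rw [mul_comm (χ (S.conjAct b n)), mul_inv_cancel_right]
  exact congrArg Units.val this

/-- The non-trivial one-dimensional complex representations of `Γ` (homomorphisms
`Γ → ℂˣ = GL₁(ℂ)`) that are fixed by the action of every element of the subgroup `H` of `G`.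
For one-dimensional representations, equivalence is equality. -/
def fixedNontrivialChars (S : GroupExtension Γ G' G) (H : Subgroup G) : Set (Γ →* ℂˣ) :=
  {χ | χ ≠ 1 ∧ ∀ a : G', S.rightHom a ∈ H → S.conjChar a χ = χ}

end GroupExtension

/-! If there is no commuting lift, the count is 0. Otherwise fix one, (a, b), acting on Γ by
commuting automorphisms A, B. Then (xa, yb) commutes iff T(x,y) = x A(y) B(x)⁻¹ y⁻¹ is 1. With f =
`centralSign z`, the indicator of 1 is (f² + f)/2, so two sums over Γ × Γ suffice.

The sum of f(T)² counts pairs with T central. Expanding this indicator in the sign characters of the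
commutator pairing and summing over x, y leaves |Γ| times the number of v that A and B both fix
modulo the center (`sum_sq_twisted`). As v ↦ `commChar v` is onto the one-dimensional
representations with fibres {v, zv}, this is 2|Γ|(N + 1), the trivial representation included.

The sum of f(T) is a Gauss sum: f(T) is quadratic on its support. Its square is computed by
orthogonality, and only coboundaries, where T = 1, survive; so it equals ±2|Γ| (`sq_sum_twisted`).
Half the total is |Γ|(N + 1 ± 1). -/

/-- The element `z` is a central involution of `Γ` generating the center, and every commutator of
`Γ` lies in `{1, z}`. -/
structure IsCentralInvolution {Γ : Type u} [Group Γ] (z : Γ) : Prop where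
  ne_one : z ≠ 1
  mul_self : z * z = 1
  comm : ∀ g, z * g = g * z
  eq_of_central : ∀ g, (∀ h, h * g = g * h) → g = 1 ∨ g = z
  comm_or : ∀ x y : Γ, x * y = y * x ∨ x * y = z * (y * x)

open Classical in
/-- The sign `±1` recording whether `x` and `y` commute. -/
noncomputable def commSign {Γ : Type u} [Group Γ] (x y : Γ) : ℤ :=
  if x * y = y * x then 1 else -1

open Classical in
/-- The class function supported on `{1, z}` with values `1` and `-1`. -/
noncomputable def centralSign {Γ : Type u} [Group Γ] (z g : Γ) : ℤ :=
  if g = 1 then 1 else if g = z then -1 else 0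

theorem commSign_symm {Γ : Type u} [Group Γ] (x y : Γ) : commSign x y = commSign y x := by
  unfold commSign
  split_ifs <;> simp_all

theorem commSign_map {Γ : Type u} [Group Γ] (A : MulAut Γ) (x y : Γ) :
    commSign (A x) (A y) = commSign x y := by
  unfold commSign
  have h : A x * A y = A y * A x ↔ x * y = y * x := by
    rw [← map_mul, ← map_mul, A.injective.eq_iff]
  split_ifs <;> simp_all

theorem commSign_mul_self {Γ : Type u} [Group Γ] (x y : Γ) :
    commSign x y * commSign x y = 1 := by
  unfold commSign; split_ifs <;> rfl

theorem commSign_one_left {Γ : Type u} [Group Γ] (y : Γ) : commSign 1 y = 1 := by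
  simp [commSign]

/-- The twisted commutator `x A(y) B(x)⁻¹ y⁻¹`. -/
def twistedCommutator {Γ : Type u} [Group Γ] (A B : MulAut Γ) (x y : Γ) : Γ :=
  x * A y * (B x)⁻¹ * y⁻¹

/-! ### The commutator pairing with values ±1. -/

namespace IsCentralInvolution

variable {Γ : Type u} [Group Γ] {z : Γ}

theorem commSign_of_ne (hz : IsCentralInvolution z) {x y : Γ} (h : x * y ≠ y * x) :
    x * y = z * (y * x) := (hz.comm_or x y).resolve_left h

theorem mul_left_ne (hz : IsCentralInvolution z) (g : Γ) : z * g ≠ g := by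
  intro h; exact hz.ne_one (by simpa using h)

theorem mul_left_cancel_twice (hz : IsCentralInvolution z) (g : Γ) : z * (z * g) = g := by
  rw [← mul_assoc, hz.mul_self, one_mul]

theorem left_comm (hz : IsCentralInvolution z) (g h : Γ) : g * (z * h) = z * (g * h) := by
  rw [← mul_assoc, ← hz.comm, mul_assoc]

theorem mul_eq_cases (hz : IsCentralInvolution z) (x y : Γ) :
    (x * y = y * x ∧ commSign x y = 1) ∨ (x * y = z * (y * x) ∧ commSign x y = -1) := by
  by_cases h : x * y = y * x
  · exact .inl ⟨h, by simp [commSign, h]⟩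
  · exact .inr ⟨hz.commSign_of_ne h, by simp [commSign, h]⟩

theorem commSign_mul_left (hz : IsCentralInvolution z) (x x' y : Γ) :
    commSign (x * x') y = commSign x y * commSign x' y := by
  have same (h : x * x' * y = y * (x * x')) : commSign (x * x') y = 1 := if_pos h
  have diff (h : x * x' * y = z * (y * (x * x'))) : commSign (x * x') y = -1 :=
    if_neg (by rw [h]; exact hz.mul_left_ne _)
  rcases hz.mul_eq_cases x y with ⟨h, e⟩ | ⟨h, e⟩ <;>
  rcases hz.mul_eq_cases x' y with ⟨h', e'⟩ | ⟨h', e'⟩ <;> rw [e, e']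
  · exact same (by rw [mul_assoc, h', ← mul_assoc, h, mul_assoc])
  · exact diff (by rw [mul_assoc, h', hz.left_comm, ← mul_assoc x, h, mul_assoc y])
  · exact diff (by rw [mul_assoc, h', ← mul_assoc, h, mul_assoc, mul_assoc])
  · exact same (by
      rw [mul_assoc, h', hz.left_comm, ← mul_assoc x, h, mul_assoc, mul_assoc,
        hz.mul_left_cancel_twice])

theorem commSign_mul_right (hz : IsCentralInvolution z) (x y y' : Γ) :
    commSign x (y * y') = commSign x y * commSign x y' := by
  rw [commSign_symm, hz.commSign_mul_left, commSign_symm y, commSign_symm y']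

/-- The sign character `commSign v` of `Γ`. -/
noncomputable def commSignHom (hz : IsCentralInvolution z) (v : Γ) : Γ →* ℤ where
  toFun := commSign v
  map_one' := by rw [commSign_symm, commSign_one_left]
  map_mul' := hz.commSign_mul_right v

theorem commSign_inv_left (hz : IsCentralInvolution z) (x y : Γ) :
    commSign x⁻¹ y = commSign x y := by
  have h := hz.commSign_mul_left x⁻¹ x y
  rw [inv_mul_cancel, commSign_one_left] at h
  calc commSign x⁻¹ y = commSign x⁻¹ y * (commSign x y * commSign x y) := by
        rw [commSign_mul_self, mul_one]
    _ = commSign x y := by rw [← mul_assoc, ← h, one_mul]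

theorem commSign_inv_right (hz : IsCentralInvolution z) (x y : Γ) :
    commSign x y⁻¹ = commSign x y := by
  rw [commSign_symm, hz.commSign_inv_left, commSign_symm]

/-! ### The class function supported on the center. -/

theorem centralSign_one : centralSign z 1 = 1 := by simp [centralSign]

theorem centralSign_mul (hz : IsCentralInvolution z) (g : Γ) :
    centralSign z (z * g) = -centralSign z g := by
  unfold centralSign
  by_cases h1 : g = 1
  · simp [h1, hz.ne_one]
  by_cases h2 : g = z
  · simp [h2, hz.ne_one, hz.mul_self]
  have h3 : z * g ≠ 1 := fun h => h2 (by simpa [hz.mul_left_cancel_twice] using congrArg (z * ·) h)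
  simp [h1, h2, h3]

theorem centralSign_cases (g : Γ) : g = 1 ∨ g = z ∨ centralSign z g = 0 := by
  unfold centralSign
  split_ifs with h1 h2
  · exact .inl h1
  · exact .inr (.inl h2)
  · exact .inr (.inr rfl)

theorem centralSign_self (hz : IsCentralInvolution z) : centralSign z z = -1 := by
  simp [centralSign, hz.ne_one]

theorem centralSign_mul_comm (hz : IsCentralInvolution z) (g h : Γ) :
    centralSign z (g * h) = centralSign z (h * g) := by
  have h1 : g * h = 1 ↔ h * g = 1 := mul_eq_one_comm
  have h2 : g * h = z ↔ h * g = z := by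
    constructor <;> intro e
    · rw [← mul_left_cancel_iff (a := g), ← mul_assoc, e, hz.comm]
    · rw [← mul_left_cancel_iff (a := h), ← mul_assoc, e, hz.comm]
  unfold centralSign
  split_ifs <;> simp_all

theorem centralSign_swap (hz : IsCentralInvolution z) (p x y q : Γ) :
    centralSign z (p * (x * y) * q) = commSign x y * centralSign z (p * (y * x) * q) := by
  rcases hz.mul_eq_cases x y with ⟨h, e⟩ | ⟨h, e⟩
  · rw [h, e, one_mul]
  · rw [h, e, hz.left_comm, mul_assoc z, hz.centralSign_mul]; ring

/-- Cyclic invariance turns p g q into g (q p). If q p is central it comes out as a sign; otherwise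
both sides vanish. -/
theorem centralSign_mul_sandwich (hz : IsCentralInvolution z) (p g q : Γ) :
    centralSign z (p * q) * centralSign z (p * g * q) =
      centralSign z (p * q) ^ 2 * centralSign z g := by
  rw [mul_assoc p, hz.centralSign_mul_comm p (g * q), mul_assoc, hz.centralSign_mul_comm p q]
  rcases centralSign_cases (z := z) (q * p) with h | h | h
  · rw [h, mul_one, centralSign_one]; ring
  · rw [h, ← hz.comm, hz.centralSign_mul, hz.centralSign_self]; ring
  · rw [h]; ring

/-! ### The twisted commutator as a quadratic map. -/

/-- Two transpositions bring out T(u, w), each costing a commutator sign. The extra factor f(T(x,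
y)) makes the identity hold for all pairs, since it kills those with T(x, y) not central. -/
theorem twisted_mul (hz : IsCentralInvolution z) (A B : MulAut Γ) (x y u w : Γ) :
    centralSign z (twistedCommutator A B x y) *
        centralSign z (twistedCommutator A B (x * u) (y * w)) =
      centralSign z (twistedCommutator A B x y) ^ 2 *
        centralSign z (twistedCommutator A B u w) * (commSign u (A y) * commSign (B x) w) := by
  have h1 : twistedCommutator A B (x * u) (y * w) =
      x * (u * A y) * (A w * (B u)⁻¹ * (B x)⁻¹ * w⁻¹ * y⁻¹) := by
    simp only [twistedCommutator, map_mul, mul_inv_rev, mul_assoc]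
  have h2 : x * (A y * u) * (A w * (B u)⁻¹ * (B x)⁻¹ * w⁻¹ * y⁻¹) =
      x * A y * u * A w * (B u)⁻¹ * ((B x)⁻¹ * w⁻¹) * y⁻¹ := by
    simp only [mul_assoc]
  have h3 : x * A y * u * A w * (B u)⁻¹ * (w⁻¹ * (B x)⁻¹) * y⁻¹ =
      (x * A y) * twistedCommutator A B u w * ((B x)⁻¹ * y⁻¹) := by
    simp only [twistedCommutator, mul_assoc]
  have h4 : twistedCommutator A B x y = (x * A y) * ((B x)⁻¹ * y⁻¹) := by
    simp only [twistedCommutator, mul_assoc]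
  rw [h1, hz.centralSign_swap, h2, hz.centralSign_swap, h3, hz.commSign_inv_left,
    hz.commSign_inv_right, h4]
  linear_combination (commSign u (A y) * commSign (B x) w) *
    hz.centralSign_mul_sandwich (x * A y) (twistedCommutator A B u w) ((B x)⁻¹ * y⁻¹)

theorem map_eq (hz : IsCentralInvolution z) (A : MulAut Γ) : A z = z := by
  refine (hz.eq_of_central (A z) fun h => ?_).resolve_left fun h => hz.ne_one ?_
  · obtain ⟨k, rfl⟩ := A.surjective h
    rw [← map_mul, ← map_mul, hz.comm]
  · exact A.injective (by rw [h, map_one])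

theorem twisted_mul_left (hz : IsCentralInvolution z) (A B : MulAut Γ) (x y : Γ) :
    twistedCommutator A B (z * x) y = twistedCommutator A B x y := by
  simp only [twistedCommutator, map_mul, hz.map_eq, mul_inv_rev]
  have : (B x)⁻¹ * z⁻¹ = z⁻¹ * (B x)⁻¹ := by rw [← mul_inv_rev, ← mul_inv_rev, hz.comm]
  rw [this, mul_assoc z, mul_assoc z, mul_assoc z, hz.comm]
  have hy : y⁻¹ * z = z * y⁻¹ := (hz.comm _).symm
  have hB : (B x)⁻¹ * z = z * (B x)⁻¹ := (hz.comm _).symm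
  simp only [mul_assoc, hy]
  rw [← mul_assoc _ z, hB, mul_assoc z, inv_mul_cancel_left]

theorem twisted_mul_right (hz : IsCentralInvolution z) (A B : MulAut Γ) (x y : Γ) :
    twistedCommutator A B x (z * y) = twistedCommutator A B x y := by
  simp only [twistedCommutator, map_mul, hz.map_eq, mul_inv_rev]
  rw [hz.left_comm, mul_assoc z, mul_assoc z, hz.comm, mul_assoc, mul_assoc y⁻¹,
    inv_mul_cancel, mul_one]

/-- Invariance of the pairing under A and B gathers the four signs into one character of x and one
of y, so double sums factor. -/
theorem commSign_twisted (hz : IsCentralInvolution z) (A B : MulAut Γ) (v x y : Γ) :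
    commSign v (twistedCommutator A B x y) =
      commSign (B v * v⁻¹) (B x) * commSign (A v * v⁻¹) (A y) := by
  simp only [twistedCommutator, hz.commSign_mul_right, hz.commSign_mul_left,
    hz.commSign_inv_left, hz.commSign_inv_right, commSign_map]
  ring

theorem centralSign_sq_of_central (hz : IsCentralInvolution z) {g : Γ}
    (h : ∀ x, x * g = g * x) : centralSign z g ^ 2 = 1 := by
  rcases hz.eq_of_central g h with rfl | rfl
  · rw [centralSign_one]; rfl
  · rw [hz.centralSign_self]; rfl

theorem centralSign_of_not_central (hz : IsCentralInvolution z) {g : Γ}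
    (h : ¬ ∀ x, x * g = g * x) : centralSign z g = 0 := by
  rcases centralSign_cases (z := z) g with rfl | rfl | h'
  · simp at h
  · exact absurd (fun x => (hz.comm x).symm) h
  · exact h'

/-! ### Orthogonality and the two character sums. -/

theorem sum_commSign [Fintype Γ] (hz : IsCentralInvolution z) (v : Γ) :
    ∑ x, commSign v x = Fintype.card Γ * centralSign z v ^ 2 := by
  classical
  by_cases h : ∀ x, x * v = v * x
  · rw [hz.centralSign_sq_of_central h]
    simp [commSign, h]
  · rw [hz.centralSign_of_not_central h]
    have hne : hz.commSignHom v ≠ 1 := by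
      intro e
      apply h
      intro x
      have : commSign v x = 1 := DFunLike.congr_fun e x
      unfold commSign at this
      split_ifs at this with h'
      exact h'.symm
    have h0 : ∑ x, commSign v x = 0 := sum_hom_units_eq_zero _ hne
    rw [h0]; ring

theorem sum_commSign_map [Fintype Γ] (hz : IsCentralInvolution z) (A : MulAut Γ) (v : Γ) :
    ∑ x, commSign v (A x) = Fintype.card Γ * centralSign z v ^ 2 := by
  rw [← hz.sum_commSign v]
  exact Fintype.sum_equiv A.toEquiv _ _ fun _ => rfl

/-- Only u = p and u = zp contribute. -/
theorem sum_mul_centralSign_sq [Fintype Γ] (hz : IsCentralInvolution z) (F : Γ → ℤ)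
    (hF : ∀ g, F (z * g) = F g) (p : Γ) :
    ∑ u, F u * centralSign z (u * p⁻¹) ^ 2 = 2 * F p := by
  classical
  rw [← Fintype.sum_equiv (Equiv.mulRight p) (fun u => F (u * p) * centralSign z u ^ 2) _
    (fun u => by simp)]
  have : ∀ u, F (u * p) * centralSign z u ^ 2 =
      (if u = 1 then F p else 0) + (if u = z then F p else 0) := by
    intro u
    by_cases h1 : u = 1
    · simp [h1, hz.ne_one.symm, centralSign_one]
    by_cases h2 : u = z
    · simp [h2, hz.ne_one, hz.centralSign_self, hF]
    · simp [h1, h2, centralSign]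
  simp only [this, Finset.sum_add_distrib, Finset.sum_ite_eq', Finset.mem_univ, if_true]
  ring

theorem card_mul_centralSign_sq [Fintype Γ] (hz : IsCentralInvolution z) (A B : MulAut Γ)
    (x y : Γ) :
    (Fintype.card Γ : ℤ) * centralSign z (twistedCommutator A B x y) ^ 2 =
      ∑ v, commSign (B v * v⁻¹) (B x) * commSign (A v * v⁻¹) (A y) := by
  rw [← hz.sum_commSign]
  exact Finset.sum_congr rfl fun v _ => by rw [commSign_symm, hz.commSign_twisted]

/-- The number of pairs with central twisted commutator. -/
theorem sum_sq_twisted [Fintype Γ] (hz : IsCentralInvolution z) (A B : MulAut Γ) :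
    ∑ x, ∑ y, centralSign z (twistedCommutator A B x y) ^ 2 =
      Fintype.card Γ * ∑ v, centralSign z (B v * v⁻¹) ^ 2 * centralSign z (A v * v⁻¹) ^ 2 := by
  have hc : (Fintype.card Γ : ℤ) ≠ 0 := by exact_mod_cast Fintype.card_ne_zero
  apply mul_left_cancel₀ hc
  simp only [Finset.mul_sum, hz.card_mul_centralSign_sq]
  calc _ = ∑ v, ∑ x, ∑ y, commSign (B v * v⁻¹) (B x) * commSign (A v * v⁻¹) (A y) := by
        rw [Finset.sum_congr rfl fun x _ => Finset.sum_comm, Finset.sum_comm]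
    _ = _ := by
        refine Finset.sum_congr rfl fun v _ => ?_
        simp only [← Finset.mul_sum, ← Finset.sum_mul, hz.sum_commSign_map]
        ring

/-- When A and B are conjugation by commuting a and b, these are the factors by which conjugation by
v changes a and b, and conjugate pairs still commute. -/
theorem twisted_coboundary {A B : MulAut Γ} (hAB : A * B = B * A) (v : Γ) :
    twistedCommutator A B (v * (A v)⁻¹) (v * (B v)⁻¹) = 1 := by
  have h : A (B v) = B (A v) := DFunLike.congr_fun hAB v
  simp only [twistedCommutator, map_mul, map_inv, mul_inv_rev, inv_inv, h]
  group

/-- The Gauss sum of the twisted commutator has absolute value `2 |Γ|`. -/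
theorem sq_sum_twisted [Fintype Γ] (hz : IsCentralInvolution z) {A B : MulAut Γ}
    (hAB : A * B = B * A) :
    (∑ x, ∑ y, centralSign z (twistedCommutator A B x y)) ^ 2 = (2 * Fintype.card Γ) ^ 2 := by
  set F : Γ → Γ → ℤ := fun x y => centralSign z (twistedCommutator A B x y) with hF
  have hc : (Fintype.card Γ : ℤ) ≠ 0 := by exact_mod_cast Fintype.card_ne_zero
  have shift : ∀ x y, ∑ x', ∑ y', F x' y' = ∑ u, ∑ w, F (x * u) (y * w) := by
    intro x y
    rw [← Fintype.sum_equiv (Equiv.mulLeft x) (fun u => ∑ y', F (x * u) y') _ (fun _ => rfl)]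
    refine Finset.sum_congr rfl fun u _ => ?_
    exact (Fintype.sum_equiv (Equiv.mulLeft y) _ _ (fun _ => rfl)).symm
  -- The factor |Γ| allows f(T(x, y))² to be expanded as a sum of characters indexed by v.
  have term : ∀ x y u w, Fintype.card Γ * (F x y * F (x * u) (y * w)) =
      ∑ v, F u w * (commSign (w * (B v * v⁻¹)) (B x) * commSign (u * (A v * v⁻¹)) (A y)) := by
    intro x y u w
    rw [hF]
    dsimp only
    rw [hz.twisted_mul, mul_assoc (_ ^ 2), ← mul_assoc, hz.card_mul_centralSign_sq,
      Finset.sum_mul]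
    refine Finset.sum_congr rfl fun v _ => ?_
    rw [hz.commSign_mul_left w, hz.commSign_mul_left u, commSign_symm (B x) w]
    ring
  -- Summing over x and y forces (u, w) to be the coboundary of v modulo {1, z}: four pairs, each
  -- with F = 1.
  have inner : ∀ v, ∑ u, ∑ w, ∑ x, ∑ y,
      F u w * (commSign (w * (B v * v⁻¹)) (B x) * commSign (u * (A v * v⁻¹)) (A y)) =
      4 * (Fintype.card Γ : ℤ) ^ 2 := by
    intro v
    simp only [← Finset.mul_sum, ← Finset.sum_mul, hz.sum_commSign_map]
    have hA : A v * v⁻¹ = (v * (A v)⁻¹)⁻¹ := by group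
    have hB : B v * v⁻¹ = (v * (B v)⁻¹)⁻¹ := by group
    rw [hA, hB]
    calc _ = (Fintype.card Γ : ℤ) ^ 2 * ∑ u, (∑ w, F u w *
          centralSign z (w * (v * (B v)⁻¹)⁻¹) ^ 2) * centralSign z (u * (v * (A v)⁻¹)⁻¹) ^ 2 := by
          rw [Finset.mul_sum]
          refine Finset.sum_congr rfl fun u _ => ?_
          rw [Finset.sum_mul, Finset.mul_sum]
          exact Finset.sum_congr rfl fun w _ => by ring
      _ = (Fintype.card Γ : ℤ) ^ 2 * ∑ u, (2 * F u (v * (B v)⁻¹)) *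
          centralSign z (u * (v * (A v)⁻¹)⁻¹) ^ 2 := by
          congr 1
          refine Finset.sum_congr rfl fun u _ => ?_
          rw [hz.sum_mul_centralSign_sq (F u) (fun g => by simp only [hF, hz.twisted_mul_right])]
      _ = _ := by
          rw [hz.sum_mul_centralSign_sq (fun u => 2 * F u (v * (B v)⁻¹))
            (fun g => by simp only [hF, hz.twisted_mul_left])]
          simp only [hF, twisted_coboundary hAB, centralSign_one]
          ring
  apply mul_left_cancel₀ hc
  calc (Fintype.card Γ : ℤ) * (∑ x, ∑ y, F x y) ^ 2
      = ∑ x, ∑ y, ∑ u, ∑ w, Fintype.card Γ * (F x y * F (x * u) (y * w)) := by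
        rw [sq, Finset.sum_mul, Finset.mul_sum]
        refine Finset.sum_congr rfl fun x _ => ?_
        rw [Finset.sum_mul, Finset.mul_sum]
        refine Finset.sum_congr rfl fun y _ => ?_
        rw [shift x y]
        simp only [Finset.mul_sum]
    _ = ∑ p : Γ × Γ, ∑ q : Γ × Γ, ∑ v, F q.1 q.2 *
        (commSign (q.2 * (B v * v⁻¹)) (B p.1) * commSign (q.1 * (A v * v⁻¹)) (A p.2)) := by
        simp only [term, Fintype.sum_prod_type]
    _ = ∑ v, ∑ q : Γ × Γ, ∑ p : Γ × Γ, F q.1 q.2 *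
        (commSign (q.2 * (B v * v⁻¹)) (B p.1) * commSign (q.1 * (A v * v⁻¹)) (A p.2)) := by
        rw [Finset.sum_comm, Finset.sum_congr rfl fun q _ => Finset.sum_comm, Finset.sum_comm]
    _ = ∑ v : Γ, 4 * (Fintype.card Γ : ℤ) ^ 2 := by
        refine Finset.sum_congr rfl fun v _ => ?_
        rw [← inner v]
        simp only [Fintype.sum_prod_type]
    _ = _ := by
        rw [Finset.sum_const, Finset.card_univ, nsmul_eq_mul]; ring

/-- Twice the number of pairs with trivial twisted commutator. -/
theorem two_mul_card_twisted_eq_one [Fintype Γ] [DecidableEq Γ] (z : Γ) (A B : MulAut Γ) :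
    2 * ((Finset.univ.filter fun p : Γ × Γ => twistedCommutator A B p.1 p.2 = 1).card : ℤ) =
      ∑ x, ∑ y, centralSign z (twistedCommutator A B x y) ^ 2 +
        ∑ x, ∑ y, centralSign z (twistedCommutator A B x y) := by
  rw [Finset.card_filter, Nat.cast_sum, Finset.mul_sum, Fintype.sum_prod_type,
    ← Finset.sum_add_distrib]
  refine Finset.sum_congr rfl fun x _ => ?_
  rw [← Finset.sum_add_distrib]
  refine Finset.sum_congr rfl fun y _ => ?_
  dsimp only
  generalize twistedCommutator A B x y = g
  unfold centralSign
  split_ifs <;> simp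

/-! ### One-dimensional representations as commutator characters. -/

/-- The complex character `commSign v` of `Γ`. -/
noncomputable def commChar (hz : IsCentralInvolution z) (v : Γ) : Γ →* ℂˣ :=
  ((Int.castRingHom ℂ : ℤ →* ℂ).comp (hz.commSignHom v)).toHomUnits

theorem commChar_apply (hz : IsCentralInvolution z) (v x : Γ) :
    ((hz.commChar v x : ℂˣ) : ℂ) = commSign v x := rfl

theorem commChar_eq_iff (hz : IsCentralInvolution z) (v w : Γ) :
    hz.commChar v = hz.commChar w ↔ v = w ∨ v = z * w := by
  have h1 : hz.commChar v = hz.commChar w ↔ ∀ x, commSign v x = commSign w x := by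
    constructor
    · intro h x
      have := congrArg (fun χ : Γ →* ℂˣ => ((χ x : ℂˣ) : ℂ)) h
      simpa only [commChar_apply, Int.cast_inj] using this
    · intro h
      ext x
      rw [commChar_apply, commChar_apply, h]
  rw [h1]
  constructor
  · intro h
    have hc : ∀ x, x * (v * w⁻¹) = (v * w⁻¹) * x := by
      intro x
      rcases hz.mul_eq_cases (v * w⁻¹) x with ⟨h', _⟩ | ⟨_, e⟩
      · exact h'.symm
      · rw [hz.commSign_mul_left, hz.commSign_inv_left, h, commSign_mul_self] at e
        norm_num at e
    rcases hz.eq_of_central _ hc with h' | h'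
    · exact .inl (mul_inv_eq_one.mp h')
    · exact .inr (mul_inv_eq_iff_eq_mul.mp h')
  · rintro (rfl | rfl) x
    · rfl
    · rw [hz.commSign_mul_left]
      simp [commSign, hz.comm x]

/-- Composing with A replaces the label v by A⁻¹ v, and labels matter only modulo {1, z}. -/
theorem commChar_comp_eq_iff (hz : IsCentralInvolution z) (A : MulAut Γ) (v : Γ) :
    (hz.commChar v).comp A.toMonoidHom = hz.commChar v ↔
      centralSign z (A v * v⁻¹) ^ 2 = 1 := by
  have h1 : (hz.commChar v).comp A.toMonoidHom = hz.commChar (A.symm v) := by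
    ext x
    change ((hz.commChar v (A x) : ℂˣ) : ℂ) = _
    rw [commChar_apply, commChar_apply, ← commSign_map A (A.symm v)]
    simp
  rw [h1, hz.commChar_eq_iff]
  have h2 : (A.symm v = v ∨ A.symm v = z * v) ↔ (A v * v⁻¹ = 1 ∨ A v * v⁻¹ = z) := by
    rw [MulEquiv.symm_apply_eq, MulEquiv.symm_apply_eq, map_mul, hz.map_eq, mul_inv_eq_one,
      mul_inv_eq_iff_eq_mul, eq_comm]
    refine or_congr Iff.rfl ⟨fun h => ?_, fun h => ?_⟩
    · conv_rhs => rw [h, hz.mul_left_cancel_twice]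
    · rw [h, hz.mul_left_cancel_twice]
  rw [h2]
  generalize A v * v⁻¹ = g
  unfold centralSign
  split_ifs with h3 h4 <;> simp [*]

/-- If `Γ` is not abelian, every one-dimensional complex representation is of the form
`commSign v`. -/
theorem commChar_surjective [Fintype Γ] (hz : IsCentralInvolution z)
    (hna : ∃ x y : Γ, x * y ≠ y * x) : Function.Surjective hz.commChar := by
  intro χ
  -- In a non-abelian Γ, z is itself a commutator.
  have hχz : χ z = 1 := by
    obtain ⟨x, y, hxy⟩ := hna
    have h := congrArg χ (hz.commSign_of_ne hxy)
    simpa [mul_comm (χ x)] using h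
  by_contra! hne
  have hzero : ∀ v, ∑ x, (χ x : ℂ) * commSign v x = 0 := by
    intro v
    have hv : (Units.coeHom ℂ).comp (χ * hz.commChar v) ≠ 1 := by
      intro e
      apply hne v
      ext x
      have h1 : (χ x : ℂ) * commSign v x = 1 := DFunLike.congr_fun e x
      have h2 : (commSign v x : ℂ) * commSign v x = 1 := by
        exact_mod_cast commSign_mul_self v x
      rw [commChar_apply]
      linear_combination (χ x : ℂ) * h2 - (commSign v x : ℂ) * h1
    exact sum_hom_units_eq_zero _ hv
  -- Summing the orthogonality relations over v leaves the sum of χ over {1, z}, which cannot vanish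
  -- because χ z = 1.
  have htotal : ∑ x, (χ x : ℂ) * (centralSign z x : ℂ) ^ 2 = 0 := by
    have hc : (Fintype.card Γ : ℂ) ≠ 0 := by exact_mod_cast Fintype.card_ne_zero
    apply mul_left_cancel₀ hc
    rw [mul_zero, Finset.mul_sum]
    calc _ = ∑ x, ∑ v, (χ x : ℂ) * commSign v x := by
          refine Finset.sum_congr rfl fun x _ => ?_
          have h := congrArg (Int.cast : ℤ → ℂ) (hz.sum_commSign x)
          push_cast at h
          rw [← Finset.mul_sum, mul_left_comm, ← h]
          simp only [commSign_symm x]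
      _ = 0 := by rw [Finset.sum_comm]; exact Finset.sum_eq_zero fun v _ => hzero v
  have hval : ∀ x, (χ x : ℂ) * (centralSign z x : ℂ) ^ 2 = ((centralSign z x ^ 2 : ℤ) : ℂ) := by
    intro x
    rcases centralSign_cases (z := z) x with rfl | rfl | h
    · simp
    · simp [hχz]
    · simp [h]
  simp only [hval] at htotal
  have h0 : ∑ x : Γ, centralSign z x ^ 2 = 0 := by exact_mod_cast htotal
  have h1 := (Finset.sum_eq_zero_iff_of_nonneg fun x _ => sq_nonneg (centralSign z x)).mp h0 1
    (Finset.mem_univ _)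
  rw [centralSign_one] at h1
  norm_num at h1

/-- The number of elements of `Γ` moved by `A` and `B` only by central factors is twice the number
of one-dimensional representations fixed by `A` and `B`. -/
theorem sum_fixed_eq_two_mul_ncard [Fintype Γ] (hz : IsCentralInvolution z)
    (hna : ∃ x y : Γ, x * y ≠ y * x) (A B : MulAut Γ) :
    ∑ v, centralSign z (B v * v⁻¹) ^ 2 * centralSign z (A v * v⁻¹) ^ 2 =
      2 * ({χ : Γ →* ℂˣ | χ.comp A.toMonoidHom = χ ∧ χ.comp B.toMonoidHom = χ}.ncard : ℤ) := by
  classical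
  set W := Finset.univ.filter fun v : Γ => (hz.commChar v).comp A.toMonoidHom = hz.commChar v ∧
    (hz.commChar v).comp B.toMonoidHom = hz.commChar v with hW
  have hset : {χ : Γ →* ℂˣ | χ.comp A.toMonoidHom = χ ∧ χ.comp B.toMonoidHom = χ} =
      (W.image hz.commChar : Finset (Γ →* ℂˣ)) := by
    ext χ
    obtain ⟨v, rfl⟩ := hz.commChar_surjective hna χ
    simp only [Set.mem_ofPred_eq, Finset.coe_image, Set.mem_image, Finset.mem_coe, hW,
      Finset.mem_filter, Finset.mem_univ, true_and]
    constructor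
    · intro h; exact ⟨v, h, rfl⟩
    · rintro ⟨w, h, e⟩; rwa [← e]
  have hfiber : ∀ χ ∈ W.image hz.commChar, (W.filter fun v => hz.commChar v = χ).card = 2 := by
    intro χ hχ
    obtain ⟨v, hv, rfl⟩ := Finset.mem_image.mp hχ
    have : (W.filter fun w => hz.commChar w = hz.commChar v) = {v, z * v} := by
      ext w
      simp only [Finset.mem_filter, Finset.mem_insert, Finset.mem_singleton, ← hz.commChar_eq_iff,
        and_iff_right_iff_imp]
      intro h
      rw [hW, Finset.mem_filter] at hv ⊢
      rw [h]
      exact ⟨Finset.mem_univ _, hv.2⟩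
    rw [this, Finset.card_pair (hz.mul_left_ne v).symm]
  have hcard := Finset.card_eq_sum_card_image hz.commChar W
  rw [Finset.sum_congr rfl hfiber, Finset.sum_const, smul_eq_mul] at hcard
  rw [hset, Set.ncard_coe_finset, mul_comm]
  have : ((W.image hz.commChar).card : ℤ) * 2 = W.card := by exact_mod_cast hcard.symm
  rw [this, hW, Finset.card_filter, Nat.cast_sum]
  refine Finset.sum_congr rfl fun v _ => ?_
  simp only [hz.commChar_comp_eq_iff]
  have h01 : ∀ g : Γ, centralSign z g ^ 2 = 1 ∨ centralSign z g ^ 2 = 0 := by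
    intro g
    unfold centralSign
    split_ifs <;> simp
  rcases h01 (A v * v⁻¹) with hA | hA <;> rcases h01 (B v * v⁻¹) with hB | hB <;>
    simp [hA, hB]

end IsCentralInvolution

/-! ### Extra-special groups supply the involution. -/

theorem IsExtraSpecial.exists_isCentralInvolution {Γ : Type u} [Group Γ]
    (h : IsExtraSpecial 2 Γ) : ∃ z : Γ, IsCentralInvolution z := by
  obtain ⟨e⟩ := h.center_equiv
  obtain ⟨m, ⟨f⟩⟩ := h.quotient_equiv
  set c : Multiplicative (ZMod 2) := Multiplicative.ofAdd 1 with hc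
  have hcases : ∀ a : Multiplicative (ZMod 2), a = 1 ∨ a = c := by decide
  set z : Subgroup.center Γ := e.symm c with hzdef
  have hzne : z ≠ 1 := by
    rw [hzdef, Ne, MulEquiv.symm_apply_eq, map_one]; decide
  have hmem : ∀ g ∈ Subgroup.center Γ, g = 1 ∨ g = z := by
    intro g hg
    rcases hcases (e ⟨g, hg⟩) with h1 | h1
    · left
      have := (MulEquiv.map_eq_one_iff e).mp h1
      simpa using congrArg Subtype.val this
    · right
      have : (⟨g, hg⟩ : Subgroup.center Γ) = z := by rw [hzdef, ← h1, e.symm_apply_apply]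
      exact congrArg Subtype.val this
  have hcen : ∀ g, (z : Γ) * g = g * z := fun g => (Subgroup.mem_center_iff.mp z.2 g).symm
  refine ⟨z, ?_, ?_, hcen, ?_, ?_⟩
  · simpa using hzne
  · have : z * z = 1 := by
      rw [hzdef, ← map_mul, MulEquiv.symm_apply_eq, map_one]; decide
    simpa using congrArg Subtype.val this
  · exact fun g hg => hmem g (Subgroup.mem_center_iff.mpr hg)
  · intro x y
    have hq : x * y * (y * x)⁻¹ ∈ Subgroup.center Γ := by
      rw [← QuotientGroup.eq_one_iff]
      apply f.injective
      simp only [QuotientGroup.mk_mul, QuotientGroup.mk_inv, map_mul, map_inv, map_one]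
      rw [mul_comm (f y), mul_inv_cancel]
    rcases hmem _ hq with h1 | h1
    · exact .inl (mul_inv_eq_one.mp h1)
    · exact .inr (mul_inv_eq_iff_eq_mul.mp h1)

theorem IsExtraSpecial.exists_mul_ne {Γ : Type u} [Group Γ] {r : ℕ} (hr : 1 ≤ r)
    (h : IsExtraSpecial 2 Γ) (hcard : Nat.card Γ = 2 ^ (2 * r + 1)) :
    ∃ x y : Γ, x * y ≠ y * x := by
  by_contra! hcomm
  obtain ⟨e⟩ := h.center_equiv
  have htop : Subgroup.center Γ = ⊤ :=
    (Subgroup.eq_top_iff' _).mpr fun g => Subgroup.mem_center_iff.mpr fun k => hcomm k g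
  have h1 := Nat.card_congr e.toEquiv
  rw [htop, Subgroup.card_top, hcard] at h1
  have h2 : Nat.card (Multiplicative (ZMod 2)) = 2 ^ 1 := by simp
  rw [h2] at h1
  have := Nat.pow_right_injective le_rfl h1
  omega

/-! ### The action on representations and the parametrization of commuting lifts. -/

namespace GroupExtension

variable {Γ : Type u} {G' : Type v} {G : Type w} [Group Γ] [Group G'] [Group G]

theorem conjChar_mul (S : GroupExtension Γ G' G) (a b : G') (χ : Γ →* ℂˣ) :
    S.conjChar (a * b) χ = S.conjChar b (S.conjChar a χ) := by
  ext γ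
  simp [conjChar]

theorem conjChar_one (S : GroupExtension Γ G' G) (χ : Γ →* ℂˣ) : S.conjChar 1 χ = χ := by
  ext γ
  simp [conjChar]

/-- The elements of `G'` fixing the one-dimensional representation `χ`. -/
def charStabilizer (S : GroupExtension Γ G' G) (χ : Γ →* ℂˣ) : Subgroup G' where
  carrier := {a | S.conjChar a χ = χ}
  one_mem' := S.conjChar_one χ
  mul_mem' := by
    intro a b (ha : S.conjChar a χ = χ) (hb : S.conjChar b χ = χ)
    change S.conjChar (a * b) χ = χ
    rw [conjChar_mul, ha, hb]
  inv_mem' := by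
    intro a (ha : S.conjChar a χ = χ)
    change S.conjChar a⁻¹ χ = χ
    calc S.conjChar a⁻¹ χ = S.conjChar a⁻¹ (S.conjChar a χ) := by rw [ha]
      _ = χ := by rw [← conjChar_mul, mul_inv_cancel, conjChar_one]

/-- A representation is fixed by `⟨α, β⟩` if and only if it is fixed by lifts of `α` and `β`. -/
theorem fixed_closure_pair_iff (S : GroupExtension Γ G' G) (a b : G') (χ : Γ →* ℂˣ) :
    (∀ c : G', S.rightHom c ∈ Subgroup.closure {S.rightHom a, S.rightHom b} →
      S.conjChar c χ = χ) ↔ S.conjChar a χ = χ ∧ S.conjChar b χ = χ := by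
  constructor
  · intro h
    exact ⟨h a (Subgroup.subset_closure (by simp)), h b (Subgroup.subset_closure (by simp))⟩
  · rintro ⟨ha, hb⟩ c hc
    have hle : Subgroup.closure {S.rightHom a, S.rightHom b} ≤
        (S.charStabilizer χ).map S.rightHom := by
      rw [Subgroup.closure_le]
      rintro g (rfl | rfl)
      · exact ⟨a, ha, rfl⟩
      · exact ⟨b, hb, rfl⟩
    obtain ⟨d, hd, e⟩ := hle hc
    rw [S.conjChar_eq_of_rightHom_eq e.symm]
    exact hd

theorem insert_one_fixedNontrivialChars (S : GroupExtension Γ G' G) (a b : G') :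
    insert 1 (S.fixedNontrivialChars (Subgroup.closure {S.rightHom a, S.rightHom b})) =
      {χ : Γ →* ℂˣ | χ.comp (S.conjAct a).toMonoidHom = χ ∧
        χ.comp (S.conjAct b).toMonoidHom = χ} := by
  ext χ
  simp only [fixedNontrivialChars, Set.mem_insert_iff, Set.mem_ofPred_eq,
    S.fixed_closure_pair_iff]
  by_cases h : χ = 1
  · simp [h]
  · simp [h, conjChar]

theorem commutingLifts_eq_image (S : GroupExtension Γ G' G) {a b : G'} (hab : a * b = b * a) :
    S.commutingLifts (S.rightHom a) (S.rightHom b) =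
      (fun p : Γ × Γ => (S.inl p.1 * a, S.inl p.2 * b)) ''
        {p | twistedCommutator (S.conjAct a) (S.conjAct b) p.1 p.2 = 1} := by
  have key : ∀ x y, (S.inl x * a) * (S.inl y * b) = (S.inl y * b) * (S.inl x * a) ↔
      twistedCommutator (S.conjAct a) (S.conjAct b) x y = 1 := by
    intro x y
    have h1 : (S.inl x * a) * (S.inl y * b) = S.inl (x * S.conjAct a y) * (a * b) := by
      rw [map_mul, S.inl_conjAct_comm]; group
    have h2 : (S.inl y * b) * (S.inl x * a) = S.inl (y * S.conjAct b x) * (a * b) := by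
      rw [map_mul, S.inl_conjAct_comm, hab]; group
    rw [h1, h2, mul_right_cancel_iff, S.inl_injective.eq_iff, twistedCommutator, mul_inv_eq_one,
      mul_inv_eq_iff_eq_mul]
  have lift : ∀ c d : G', S.rightHom c = S.rightHom d → ∃ x, S.inl x * d = c := by
    intro c d h
    have : c * d⁻¹ ∈ S.inl.range := by
      rw [S.range_inl_eq_ker_rightHom, MonoidHom.mem_ker, map_mul, map_inv, h, mul_inv_cancel]
    obtain ⟨x, hx⟩ := this
    exact ⟨x, by rw [hx, inv_mul_cancel_right]⟩
  ext ⟨c, d⟩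
  simp only [commutingLifts, Set.mem_ofPred_eq, Set.mem_image, Prod.exists, Prod.mk.injEq]
  constructor
  · rintro ⟨hc, hd, hcd⟩
    obtain ⟨x, rfl⟩ := lift c a hc
    obtain ⟨y, rfl⟩ := lift d b hd
    exact ⟨x, y, (key x y).mp hcd, rfl, rfl⟩
  · rintro ⟨x, y, h, rfl, rfl⟩
    exact ⟨by simp, by simp, (key x y).mpr h⟩

theorem finite_commutingLifts [Finite Γ] (S : GroupExtension Γ G' G) (α β : G) :
    (S.commutingLifts α β).Finite := by
  rcases (S.commutingLifts α β).eq_empty_or_nonempty with h | ⟨⟨a, b⟩, rfl, rfl, hab⟩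
  · rw [h]; exact Set.finite_empty
  · rw [S.commutingLifts_eq_image hab]; exact Set.toFinite _

theorem ncard_commutingLifts [Finite Γ] (S : GroupExtension Γ G' G) {a b : G'}
    (hab : a * b = b * a) :
    (S.commutingLifts (S.rightHom a) (S.rightHom b)).ncard =
      {p : Γ × Γ | twistedCommutator (S.conjAct a) (S.conjAct b) p.1 p.2 = 1}.ncard := by
  rw [S.commutingLifts_eq_image hab]
  refine Set.ncard_image_of_injective _ ?_
  rintro ⟨x, y⟩ ⟨x', y'⟩ h
  simpa [S.inl_injective.eq_iff] using h

end GroupExtension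

theorem mainTheorem6 {Γ : Type u} {G' : Type v} {G : Type w} [Group Γ] [Group G'] [Group G]
    (r : ℕ) (hr : 1 ≤ r) (hΓ : IsExtraSpecial 2 Γ) (hcard : Nat.card Γ = 2 ^ (2 * r + 1))
    (S : GroupExtension Γ G' G) (α β : G) (hαβ : α * β = β * α)
    (N : ℕ) (hN : N = (S.fixedNontrivialChars (Subgroup.closure {α, β})).ncard) :
    (S.fixedNontrivialChars (Subgroup.closure {α, β})).Finite ∧
    (S.commutingLifts α β).Finite ∧
    ((S.commutingLifts α β).ncard = 0 ∨
      ((S.commutingLifts α β).ncard : ℤ) = 2 ^ (2 * r + 1) * (1 + (N : ℤ) + 1) ∨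
      ((S.commutingLifts α β).ncard : ℤ) = 2 ^ (2 * r + 1) * (1 + (N : ℤ) - 1)) := by
  classical
  have := hΓ.finite
  have := Fintype.ofFinite Γ
  obtain ⟨z, hz⟩ := hΓ.exists_isCentralInvolution
  have hna := hΓ.exists_mul_ne hr hcard
  have hfin : (S.fixedNontrivialChars (Subgroup.closure {α, β})).Finite :=
    haveI := Finite.of_surjective _ (hz.commChar_surjective hna)
    Set.toFinite _
  refine ⟨hfin, S.finite_commutingLifts α β, ?_⟩
  rcases (S.commutingLifts α β).eq_empty_or_nonempty with h | ⟨⟨a, b⟩, rfl, rfl, hab⟩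
  · left; rw [h, Set.ncard_empty]
  right
  dsimp only at *
  have hAB : S.conjAct a * S.conjAct b = S.conjAct b * S.conjAct a := by
    rw [← map_mul, ← map_mul, hab]
  -- Inserting the trivial representation turns N into N + 1.
  have hcount := IsCentralInvolution.two_mul_card_twisted_eq_one z (S.conjAct a) (S.conjAct b)
  rw [hz.sum_sq_twisted, hz.sum_fixed_eq_two_mul_ncard hna,
    ← S.insert_one_fixedNontrivialChars a b,
    Set.ncard_insert_of_notMem (fun h => h.1 rfl) hfin, ← hN] at hcount
  have hL : (S.commutingLifts (S.rightHom a) (S.rightHom b)).ncard =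
      (Finset.univ.filter fun p : Γ × Γ =>
        twistedCommutator (S.conjAct a) (S.conjAct b) p.1 p.2 = 1).card := by
    rw [S.ncard_commutingLifts hab, ← Set.ncard_coe_finset]
    simp
  have hc : (Fintype.card Γ : ℤ) = 2 ^ (2 * r + 1) := by
    rw [← Nat.card_eq_fintype_card, hcard]; push_cast; rfl
  rw [hL, ← hc]
  push_cast at hcount
  rcases sq_eq_sq_iff_eq_or_eq_neg.mp (hz.sq_sum_twisted hAB) with h | h <;> rw [h] at hcount
  · left; linarith
  · right; linarith
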